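/- For a prime $p$ and an integer $u$ with $\gcd(u,p)=1$, the Fermat quotient $q_p(u)$ is the unique integer with $$q_p(u)\equiv \frac{u^{p-1}-1}{p} \pmod p,\qquad 0\le q_p(u)\le p-1,$$ and for a positive integer $N$ let $$I_p(N)=\#\{q_p(n)\ :\ 1\le n\le N,\ \gcd(n,p)=1\}.$$ For every real $\varepsilon>0$ there exist $\delta>0$ and $p_0$, both depending only on $\varepsilon$, such that for every prime $p\ge p_0$ and every integer $N$ with $p^{\varepsilon}<N<p$ we have $$I_p(N)\ge p^{\delta}.$$ -/

import Mathlib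

/-- The Fermat quotient `q_p(u)`: the residue in `{0, …, p - 1}` modulo `p` of the number
`(u ^ (p - 1) - 1) / p`, which is an integer when `p` is prime and `gcd(u, p) = 1`. It is only
used for such `p` and `u`. -/
def fermatQuotient (p : ℕ) (u : ℤ) : ℤ :=
  ((u ^ (p - 1) - 1) / (p : ℤ)) % (p : ℤ)

/-- The image size `I_p(N) = #{q_p(n) : 1 ≤ n ≤ N, gcd(n, p) = 1}`. -/
def fermatImageSize (p N : ℕ) : ℕ :=
  (((Finset.Icc 1 N).filter (fun n : ℕ => Nat.gcd n p = 1)).image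
    (fun n : ℕ => fermatQuotient p (n : ℤ))).card

/-! The Fermat quotient satisfies `u ^ (p - 1) ≡ 1 + p * q_p(u)` modulo `p ^ 2`, so it is additive
modulo `p` on products, and it determines `u` modulo `p ^ 2` once `u` is known modulo `p`. If
`N < p` and `N ^ k ≤ p ^ 2`, unique factorization makes the products of `k` primes up to `N` at
least `π(N) ^ k / k!` distinct integers below `p ^ 2`. Their quotients lie in the `k`-fold sumset of
the quotients up to `N`, whence `π(N) ^ k ≤ k! * (I_p(N) ^ k * p)`. For `N = ⌊p ^ (2 / k)⌋`,
Chebyshev's bound makes the left-hand side almost `p ^ 2`, which leaves almost `p ^ (1 / k)` for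
`I_p(N)`; larger `N` only increase `I_p(N)`. -/

open Asymptotics Filter Finset
open scoped Nat Nat.Prime Pointwise

section FermatQuotient

variable {p : ℕ} {u v : ℤ}

lemma pow_pred_modEq_one_add_mul_fermatQuotient (hp : p.Prime) (hu : IsCoprime u p) :
    u ^ (p - 1) ≡ 1 + p * fermatQuotient p u [ZMOD p ^ 2] := by
  have hdvd : (p : ℤ) ∣ u ^ (p - 1) - 1 := (Int.ModEq.pow_card_sub_one_eq_one hp hu).symm.dvd
  have hmod : (u ^ (p - 1) - 1) / p ≡ fermatQuotient p u [ZMOD p] := (Int.mod_modEq _ _).symm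
  calc u ^ (p - 1) = 1 + p * ((u ^ (p - 1) - 1) / p) := by rw [Int.mul_ediv_cancel' hdvd]; ring
    _ ≡ 1 + p * fermatQuotient p u [ZMOD p ^ 2] := by rw [sq]; exact hmod.mul_left'.add_left 1

lemma one_add_mul_modEq_sq_iff (hp : p ≠ 0) {a b : ℤ} :
    1 + p * a ≡ 1 + p * b [ZMOD p ^ 2] ↔ (a : ZMod p) = b := by
  rw [ZMod.intCast_eq_intCast_iff, sq]
  exact ⟨fun h => Int.ModEq.mul_left_cancel' (mod_cast hp) (h.add_left_cancel' 1),
    fun h => h.mul_left'.add_left 1⟩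

lemma fermatQuotient_one (p : ℕ) : fermatQuotient p 1 = 0 := by
  simp [fermatQuotient]

lemma cast_fermatQuotient_mul (hp : p.Prime) (hu : IsCoprime u p) (hv : IsCoprime v p) :
    (fermatQuotient p (u * v) : ZMod p) = fermatQuotient p u + fermatQuotient p v := by
  rw [← Int.cast_add, ← one_add_mul_modEq_sq_iff hp.ne_zero]
  set a := fermatQuotient p u
  set b := fermatQuotient p v
  calc 1 + p * fermatQuotient p (u * v)
      ≡ (u * v) ^ (p - 1) [ZMOD p ^ 2] :=
        (pow_pred_modEq_one_add_mul_fermatQuotient hp (hu.mul_left hv)).symm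
    _ = u ^ (p - 1) * v ^ (p - 1) := mul_pow ..
    _ ≡ (1 + p * a) * (1 + p * b) [ZMOD p ^ 2] :=
        (pow_pred_modEq_one_add_mul_fermatQuotient hp hu).mul
          (pow_pred_modEq_one_add_mul_fermatQuotient hp hv)
    _ = 1 + p * (a + b) + p ^ 2 * (a * b) := by ring
    _ ≡ 1 + p * (a + b) [ZMOD p ^ 2] := Int.modEq_add_fac_self

lemma cast_fermatQuotient_multiset_prod (hp : p.Prime) {m : Multiset ℤ}
    (hm : ∀ u ∈ m, IsCoprime u p) :
    (fermatQuotient p m.prod : ZMod p) = (m.map fun u => (fermatQuotient p u : ZMod p)).sum := by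
  induction m using Multiset.induction_on with
  | empty => simp [fermatQuotient_one]
  | cons u m ih =>
    obtain ⟨hu, hm⟩ := Multiset.forall_mem_cons.1 hm
    have hprod : IsCoprime m.prod p :=
      Multiset.prod_induction (IsCoprime · (p : ℤ)) m (fun _ _ => IsCoprime.mul_left)
        isCoprime_one_left hm
    rw [Multiset.prod_cons, cast_fermatQuotient_mul hp hu hprod, ih hm, Multiset.map_cons,
      Multiset.sum_cons]

lemma modEq_sq_of_cast_fermatQuotient_eq (hp : p.Prime) (hu : IsCoprime u p)
    (hv : IsCoprime v p) (huv : u ≡ v [ZMOD p])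
    (hq : (fermatQuotient p u : ZMod p) = fermatQuotient p v) : u ≡ v [ZMOD p ^ 2] := by
  have hpred : u ^ (p - 1) ≡ v ^ (p - 1) [ZMOD p ^ 2] :=
    (pow_pred_modEq_one_add_mul_fermatQuotient hp hu).trans <|
      ((one_add_mul_modEq_sq_iff hp.ne_zero).2 hq).trans
        (pow_pred_modEq_one_add_mul_fermatQuotient hp hv).symm
  have hpow : u ^ p ≡ v ^ p [ZMOD p ^ 2] := by
    rw [Int.modEq_iff_dvd]
    simpa using dvd_sub_pow_of_dvd_sub huv.dvd 1
  have hmul : u ^ (p - 1) * u ≡ u ^ (p - 1) * v [ZMOD p ^ 2] :=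
    calc u ^ (p - 1) * u = u ^ p := pow_sub_one_mul hp.ne_zero u
      _ ≡ v ^ p [ZMOD p ^ 2] := hpow
      _ = v ^ (p - 1) * v := (pow_sub_one_mul hp.ne_zero v).symm
      _ ≡ u ^ (p - 1) * v [ZMOD p ^ 2] := hpred.symm.mul_right v
  have hdvd : (p : ℤ) ^ 2 ∣ u ^ (p - 1) * (v - u) := by
    rw [mul_sub]
    exact hmul.dvd
  exact Int.modEq_iff_dvd.2 (hu.pow.symm.dvd_of_dvd_mul_left hdvd)

end FermatQuotient

section ImageSize

variable {p : ℕ}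

/-- The residue classes of the Fermat quotients `q_p(n)` with `1 ≤ n ≤ N` and `gcd(n, p) = 1`:
the set counted by `fermatImageSize`, moved to `ZMod p` so that sumsets can be formed. -/
def fermatQuotientClasses (p N : ℕ) : Finset (ZMod p) :=
  (((Icc 1 N).filter fun n : ℕ => Nat.gcd n p = 1).image fun n : ℕ => fermatQuotient p n).image (↑)

lemma card_fermatQuotientClasses_le (p N : ℕ) :
    #(fermatQuotientClasses p N) ≤ fermatImageSize p N :=
  card_image_le

lemma fermatImageSize_mono (p : ℕ) : Monotone (fermatImageSize p) := fun _ _ h =>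
  card_le_card (image_subset_image (filter_subset_filter _ (Icc_subset_Icc_right h)))

lemma card_le_of_cast_fermatQuotient_mem (hp : p.Prime) {ι : Type*} [Fintype ι] {f : ι → ℕ}
    (hf : f.Injective) (hlt : ∀ i, f i < p ^ 2) (hcop : ∀ i, (f i).Coprime p)
    {B : Finset (ZMod p)} (hB : ∀ i, (fermatQuotient p (f i) : ZMod p) ∈ B) :
    Fintype.card ι ≤ #B * p := by
  have : NeZero p := ⟨hp.ne_zero⟩
  have hinj : Function.Injective fun i =>
      ((fermatQuotient p (f i) : ZMod p), (f i : ZMod p)) := by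
    intro i j hij
    obtain ⟨hq, hmod⟩ := Prod.mk.inj hij
    have hsq := modEq_sq_of_cast_fermatQuotient_eq hp (Nat.isCoprime_iff_coprime.2 (hcop i))
      (Nat.isCoprime_iff_coprime.2 (hcop j))
      (Int.natCast_modEq_iff.2 ((ZMod.natCast_eq_natCast_iff _ _ _).1 hmod)) hq
    exact hf (Nat.ModEq.eq_of_lt_of_lt (Int.natCast_modEq_iff.1 (mod_cast hsq)) (hlt i) (hlt j))
  calc Fintype.card ι
      ≤ #(B ×ˢ (univ : Finset (ZMod p))) :=
        card_le_card_of_injOn _ (fun i _ => mem_product.2 ⟨hB i, mem_univ _⟩) hinj.injOn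
    _ = #B * p := by rw [card_product, card_univ, ZMod.card]

lemma cast_fermatQuotient_prod_mem_nsmul (hp : p.Prime) {N k : ℕ} {m : Multiset ℕ}
    (hm : ∀ n ∈ m, n ∈ Icc 1 N ∧ n.Coprime p) (hk : m.card = k) :
    (fermatQuotient p (m.prod : ℕ) : ZMod p) ∈ k • fermatQuotientClasses p N := by
  have hclass : ∀ n ∈ m,
      (fermatQuotient p n : ZMod p) ∈ (fermatQuotientClasses p N : Set (ZMod p)) :=
    fun n hn => mem_image_of_mem _ (mem_image_of_mem _ (mem_filter.2 (hm n hn)))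
  have hsum := Set.multiset_sum_mem_multiset_sum m _ _ hclass
  rw [Multiset.map_const', Multiset.sum_replicate, hk, ← coe_nsmul, mem_coe] at hsum
  rw [Nat.cast_multiset_prod, cast_fermatQuotient_multiset_prod hp, Multiset.map_map]
  · exact hsum
  · simpa only [Multiset.forall_mem_map_iff, Nat.isCoprime_iff_coprime]
      using fun n hn => (hm n hn).2

end ImageSize

section PrimeProducts

lemma multiset_prod_map_injective_of_prime {α ι : Type*} [CommMonoidWithZero α]
    [UniqueFactorizationMonoid α] [Subsingleton αˣ] {f : ι → α} (hf : f.Injective)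
    (hprime : ∀ i, Prime (f i)) : Function.Injective fun m : Multiset ι => (m.map f).prod := by
  have hfactors (m : Multiset ι) :
      UniqueFactorizationMonoid.normalizedFactors (m.map f).prod = m.map f :=
    UniqueFactorizationMonoid.normalizedFactors_prod_of_prime <|
      Multiset.forall_mem_map_iff.2 fun i _ => hprime i
  intro m₁ m₂ (h : (m₁.map f).prod = (m₂.map f).prod)
  refine Multiset.map_injective hf ?_
  rw [← hfactors m₁, h, hfactors m₂]

lemma pow_le_factorial_mul_multichoose (n k : ℕ) : n ^ k ≤ k ! * n.multichoose k := by
  rw [Nat.multichoose_eq, ← Nat.ascFactorial_eq_factorial_mul_choose']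
  exact Nat.pow_succ_le_ascFactorial n k

lemma primeCounting_pow_le {p N k : ℕ} (hp : p.Prime) (hN : N < p) (hk : N ^ k ≤ p ^ 2) :
    π N ^ k ≤ k ! * (fermatImageSize p N ^ k * p) := by
  let f (m : Sym (Nat.primesLE N) k) : ℕ := ((m : Multiset (Nat.primesLE N)).map (↑)).prod
  have hf : f.Injective :=
    (multiset_prod_map_injective_of_prime Subtype.val_injective fun q =>
      (Nat.prime_of_mem_primesLE q.2).prime).comp Sym.coe_injective
  have hmem (m : Sym (Nat.primesLE N) k) :
      ∀ q ∈ (m : Multiset (Nat.primesLE N)).map (↑), q ∈ Icc 1 N ∧ q.Coprime p := by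
    refine Multiset.forall_mem_map_iff.2 fun q _ => ?_
    have hq := Nat.prime_of_mem_primesLE q.2
    have hqN := Nat.le_of_mem_primesLE q.2
    exact ⟨mem_Icc.2 ⟨hq.one_le, hqN⟩, (Nat.coprime_primes hq hp).2 (hqN.trans_lt hN).ne⟩
  have hcop (m : Sym (Nat.primesLE N) k) : (f m).Coprime p :=
    Multiset.prod_induction (Nat.Coprime · p) _ (fun _ _ => Nat.Coprime.mul_left)
      (Nat.coprime_one_left p) fun q hq => (hmem m q hq).2
  have hlt (m : Sym (Nat.primesLE N) k) : f m < p ^ 2 := by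
    have hle : f m ≤ N ^ k := by
      simpa using Multiset.prod_le_pow_card _ N fun q hq => (mem_Icc.1 (hmem m q hq).1).2
    refine (hle.trans hk).lt_of_ne fun h => hp.one_lt.ne' ?_
    simpa [h, Nat.coprime_pow_left_iff] using hcop m
  calc π N ^ k
      ≤ k ! * (π N).multichoose k := pow_le_factorial_mul_multichoose _ _
    _ = k ! * Fintype.card (Sym (Nat.primesLE N) k) := by
        rw [Sym.card_sym_eq_multichoose, Fintype.card_coe, Nat.primesLE_card_eq_primeCounting]
    _ ≤ k ! * (#(k • fermatQuotientClasses p N) * p) := by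
        gcongr
        exact card_le_of_cast_fermatQuotient_mem hp hf hlt hcop fun m =>
          cast_fermatQuotient_prod_mem_nsmul hp (hmem m) (by simp)
    _ ≤ k ! * (fermatImageSize p N ^ k * p) := by
        gcongr
        exact card_nsmul_le.trans (by gcongr; exact card_fermatQuotientClasses_le p N)

end PrimeProducts

section Asymptotics

lemma isBigO_id_psi : (fun x : ℝ => x) =O[atTop] Chebyshev.psi := by
  refine IsBigO.of_bound 4 ?_
  filter_upwards [eventually_ge_atTop 7] with x hx
  have hlog : Real.log (x + 2) ≤ (x + 2) / 8 - 1 + 3 * Real.log 2 := by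
    have h := Real.log_le_sub_one_of_pos (show 0 < (x + 2) / 2 ^ 3 by positivity)
    rw [Real.log_div (by positivity) (by positivity), Real.log_pow] at h
    push_cast at h
    linarith
  have hpsi := Chebyshev.psi_ge' (show 0 ≤ x by linarith)
  rw [Real.norm_of_nonneg (by linarith), Real.norm_of_nonneg (Chebyshev.psi_nonneg x)]
  nlinarith [Real.log_two_gt_d9, Real.log_two_lt_d9]

lemma isLittleO_rpow_primeCounting {s : ℝ} (hs : s < 1) :
    (fun x : ℝ => x ^ s) =o[atTop] fun x => (π ⌊x⌋₊ : ℝ) := by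
  have hpsi : Chebyshev.psi =O[atTop] fun x => (π ⌊x⌋₊ : ℝ) * Real.log x :=
    IsBigO.of_norm_le fun x => by
      rw [Real.norm_of_nonneg (Chebyshev.psi_nonneg x)]
      exact Chebyshev.psi_le_primeCounting_mul_log' x
  have hmul : (fun x : ℝ => x ^ s * Real.log x) =o[atTop] fun x => (π ⌊x⌋₊ : ℝ) * Real.log x := by
    refine IsLittleO.trans_isBigO ?_ (isBigO_id_psi.trans hpsi)
    refine ((isBigO_refl (fun x : ℝ => x ^ s) atTop).mul_isLittleO
      (isLittleO_log_rpow_atTop (sub_pos.2 hs))).congr' .rfl ?_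
    filter_upwards [eventually_gt_atTop 0] with x hx
    rw [← Real.rpow_add hx, add_sub_cancel, Real.rpow_one]
  have hlog : ∀ᶠ x : ℝ in atTop, Real.log x ≠ 0 :=
    Real.tendsto_log_atTop.eventually_ne_atTop 0
  refine (hmul.mul_isBigO (isBigO_refl (fun x => (Real.log x)⁻¹) atTop)).congr' ?_ ?_ <;>
    filter_upwards [hlog] with x hx using mul_inv_cancel_right₀ hx _

lemma primeCounting_floor_rpow_pow_le {p k : ℕ} (hp : p.Prime) (hk : 2 < k) :
    (π ⌊(p : ℝ) ^ (2 / k : ℝ)⌋₊ : ℝ) ^ k ≤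
      k ! * ((fermatImageSize p ⌊(p : ℝ) ^ (2 / k : ℝ)⌋₊ : ℝ) ^ k * p) := by
  have hk0 : (0 : ℝ) < k := by positivity
  have hlt : ⌊(p : ℝ) ^ (2 / k : ℝ)⌋₊ < p := by
    rw [Nat.floor_lt (by positivity)]
    exact Real.rpow_lt_self_of_one_lt (mod_cast hp.one_lt) ((div_lt_one hk0).2 (mod_cast hk))
  have hpow : (⌊(p : ℝ) ^ (2 / k : ℝ)⌋₊ : ℝ) ^ k ≤ (p : ℝ) ^ 2 :=
    calc (⌊(p : ℝ) ^ (2 / k : ℝ)⌋₊ : ℝ) ^ k ≤ ((p : ℝ) ^ (2 / k : ℝ)) ^ k := by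
          gcongr
          exact Nat.floor_le (by positivity)
      _ = (p : ℝ) ^ 2 := by
          rw [← Real.rpow_mul_natCast p.cast_nonneg, div_mul_cancel₀ _ hk0.ne', Real.rpow_two]
  exact mod_cast primeCounting_pow_le hp hlt (mod_cast hpow)

lemma eventually_rpow_le_fermatImageSize_floor {k : ℕ} (hk : 2 < k) {δ : ℝ} (hδ : δ < 1 / k) :
    ∀ᶠ p : ℕ in atTop, p.Prime → (p : ℝ) ^ δ ≤ fermatImageSize p ⌊(p : ℝ) ^ (2 / k : ℝ)⌋₊ := by
  have hk0 : (0 : ℝ) < k := by positivity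
  obtain ⟨s, hs, hexp⟩ : ∃ s : ℝ, s < 1 ∧ (2 / k : ℝ) * s * k = δ * k + 1 := by
    refine ⟨(δ * k + 1) / 2, ?_, by field_simp⟩
    linarith [(lt_div_iff₀ hk0).1 hδ]
  have hπ : ∀ᶠ x : ℝ in atTop, k ! * x ^ s ≤ π ⌊x⌋₊ := by
    filter_upwards [((isLittleO_rpow_primeCounting hs).const_mul_left (k ! : ℝ)).eventuallyLE,
      eventually_ge_atTop 0] with x hx hx0
    rwa [Real.norm_of_nonneg (by positivity), Real.norm_of_nonneg (by positivity)] at hx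
  have htend : Tendsto (fun p : ℕ => (p : ℝ) ^ (2 / k : ℝ)) atTop atTop :=
    (tendsto_rpow_atTop (by positivity)).comp tendsto_natCast_atTop_atTop
  filter_upwards [htend.eventually hπ] with p hπ hp
  have hp0 : (0 : ℝ) < p := mod_cast hp.pos
  have hfac : (k ! : ℝ) ≤ (k ! : ℝ) ^ k :=
    le_self_pow₀ (mod_cast k.factorial_pos) (by positivity)
  have hbound : k ! * (((p : ℝ) ^ δ) ^ k * p) ≤
      k ! * ((fermatImageSize p ⌊(p : ℝ) ^ (2 / k : ℝ)⌋₊ : ℝ) ^ k * p) :=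
    calc k ! * (((p : ℝ) ^ δ) ^ k * p) = k ! * (((p : ℝ) ^ (2 / k : ℝ)) ^ s) ^ k := by
          rw [← Real.rpow_mul hp0.le, ← Real.rpow_mul_natCast hp0.le,
            ← Real.rpow_mul_natCast hp0.le, hexp, Real.rpow_add_one hp0.ne']
      _ ≤ (k ! * ((p : ℝ) ^ (2 / k : ℝ)) ^ s) ^ k := by rw [mul_pow]; gcongr
      _ ≤ (π ⌊(p : ℝ) ^ (2 / k : ℝ)⌋₊ : ℝ) ^ k := by gcongr
      _ ≤ _ := primeCounting_floor_rpow_pow_le hp hk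
  refine le_of_pow_le_pow_left₀ (n := k) (by positivity) (by positivity) ?_
  exact le_of_mul_le_mul_right (le_of_mul_le_mul_left hbound (by positivity)) hp0

end Asymptotics

theorem theorem12_general (ε : ℝ) (hε : 0 < ε) :
    ∃ δ : ℝ, 0 < δ ∧ ∃ p₀ : ℕ, ∀ p : ℕ, p.Prime → p₀ ≤ p →
      ∀ N : ℕ, (p : ℝ) ^ ε ≤ (N : ℝ) → (p : ℝ) ^ δ ≤ (fermatImageSize p N : ℝ) := by
  obtain ⟨k, hk⟩ := exists_nat_gt (max 2 (2 / ε))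
  obtain ⟨hk2, hkε⟩ := max_lt_iff.1 hk
  have hk0 : (0 : ℝ) < k := by linarith
  have hexp : 2 / (k : ℝ) ≤ ε := ((div_lt_comm₀ hε hk0).1 hkε).le
  have hδ : 1 / (2 * k : ℝ) < 1 / k := one_div_lt_one_div_of_lt hk0 (by linarith)
  obtain ⟨p₀, hp₀⟩ :=
    eventually_atTop.1 (eventually_rpow_le_fermatImageSize_floor (mod_cast hk2) hδ)
  refine ⟨1 / (2 * k), by positivity, p₀, fun p hp hpp N hN => (hp₀ p hpp hp).trans ?_⟩
  have hfloor : ⌊(p : ℝ) ^ (2 / k : ℝ)⌋₊ ≤ N := Nat.floor_le_of_le <|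
    (Real.rpow_le_rpow_of_exponent_le (mod_cast hp.one_le) hexp).trans hN
  exact mod_cast fermatImageSize_mono p hfloor

theorem theorem12 (ε : ℝ) (hε : 0 < ε) :
    ∃ δ : ℝ, 0 < δ ∧ ∃ p₀ : ℕ, ∀ p : ℕ, p.Prime → p₀ ≤ p →
      ∀ N : ℕ, (p : ℝ) ^ ε < (N : ℝ) → N < p →
        (p : ℝ) ^ δ ≤ (fermatImageSize p N : ℝ) := by
  obtain ⟨δ, hδ, p₀, h⟩ := theorem12_general ε hε
  exact ⟨δ, hδ, p₀, fun p hp hpp N hN _ => h p hp hpp N hN.le⟩
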